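/- Let $d\ge 0$, $D=d+1$, and let $\gamma=(\gamma_1,\dots,\gamma_D)^\top$ with all $\gamma_j>0$. Put $\gamma_+=\sum_{j=1}^D\gamma_j$, $\bar\gamma=\gamma_+^{-1}\gamma$ and $\Sigma=\gamma_+^{-1}\{\operatorname{diag}(\bar\gamma)-\bar\gamma\bar\gamma^\top\}$. For $b\in(0,\infty)^D$ let $$f_b(v)=\frac{\Gamma(b_1+\cdots+b_D)}{\prod_{j=1}^D\Gamma(b_j)}\prod_{j=1}^D v_j^{b_j-1}$$ for $v$ in the standard simplex $\{v\in\mathbb R^D: v_j\ge 0,\ \sum_j v_j=1\}$, and $f_b(v)=0$ for $v$ off the simplex. Let $\mathrm{Dirichlet}(b)$ be the distribution on the simplex with density $f_b$ with respect to Lebesgue measure in the first $d$ coordinates. For every real $\alpha\neq 0$ let $u^{(\alpha)}\sim\mathrm{Dirichlet}(\gamma/\alpha^2)$. Then, as $\alpha\to 0$, $$\frac1\alpha\bigl(u^{(\alpha)}-\bar\gamma\bigr)\ \xrightarrow{\ d\ }\ \mathcal N_D(0,\Sigma).$$ Moreover, for every fixed $\epsilon\in(0,1)$, as $\alpha\to0$,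 $$|\alpha|^d f_{\gamma/\alpha^2}(\bar\gamma+\alpha v)\ \longrightarrow\ \frac{1}{(2\pi)^{d/2}}\left(\frac{\gamma_+^d}{\prod_{j=1}^D\bar\gamma_j}\right)^{1/2}\exp\left(-\frac12\sum_{j=1}^D\frac{\gamma_+v_j^2}{\bar\gamma_j}\right)$$ uniformly over all $v\in\mathbb R^D$ with $\sum_{j=1}^D v_j=0$ and Euclidean norm $\|v\|\le|\alpha|^{-1+\epsilon}$; that is, the supremum over these $v$ of the absolute difference of the two sides tends to $0$. -/

import Mathlib

open MeasureTheory ProbabilityTheory Filter Topology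

noncomputable section

/-- The Dirichlet density with parameter vector `b`, as a function on `ℝ^D`:
`Γ(∑ b_j) / ∏ Γ(b_j) * ∏ v_j ^ (b_j - 1)` on the standard simplex, and `0` off the simplex. -/
def dirichletDensity {D : ℕ} (b : Fin D → ℝ) (v : EuclideanSpace ℝ (Fin D)) : ℝ :=
  open Classical in
  if (∀ j, 0 ≤ v j) ∧ ∑ j, v j = 1 then
    Real.Gamma (∑ j, b j) / (∏ j, Real.Gamma (b j)) * ∏ j, v j ^ (b j - 1)
  else 0

/-- The parametrization of the hyperplane `∑ v_j = 1` in `ℝ^(d+1)` by the first `d`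
coordinates: `(x_1, …, x_d) ↦ (x_1, …, x_d, 1 - ∑ x_j)`. -/
def simplexChart (d : ℕ) (x : Fin d → ℝ) : EuclideanSpace ℝ (Fin (d + 1)) :=
  WithLp.toLp 2 (Fin.snoc (α := fun _ => ℝ) x (1 - ∑ j, x j))

/-- The Dirichlet distribution on `ℝ^(d+1)`, carried by the standard simplex: it has density
`dirichletDensity b` with respect to Lebesgue measure in the first `d` coordinates. -/
def dirichletMeasure {d : ℕ} (b : Fin (d + 1) → ℝ) :
    Measure (EuclideanSpace ℝ (Fin (d + 1))) :=
  ((volume : Measure (Fin d → ℝ)).withDensity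
    (fun x => ENNReal.ofReal (dirichletDensity b (simplexChart d x)))).map (simplexChart d)

/-- The normalized parameter vector, with entries `γ_j / ∑ γ_k`. -/
def normalizedParam {D : ℕ} (γ : Fin D → ℝ) : EuclideanSpace ℝ (Fin D) :=
  WithLp.toLp 2 (fun j => γ j / ∑ k, γ k)

/-- The matrix `γ₊⁻¹ (diag(γ̄) - γ̄ γ̄ᵀ)`, with `γ₊ = ∑ γ_k` and `γ̄ = γ / γ₊`. -/
def limitCovariance {D : ℕ} (γ : Fin D → ℝ) : Matrix (Fin D) (Fin D) ℝ :=
  (∑ k, γ k)⁻¹ • (Matrix.diagonal (fun j => normalizedParam γ j) -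
    Matrix.vecMulVec (fun i => normalizedParam γ i) (fun j => normalizedParam γ j))

/-- The Gaussian density on the hyperplane `∑ v_j = 0` of `ℝ^(d+1)`, with respect to Lebesgue
measure in the first `d` coordinates:
`(2π)^(-d/2) (γ₊^d / ∏ γ̄_j)^(1/2) exp(-½ ∑ γ₊ v_j² / γ̄_j)`. -/
def limitDensity {d : ℕ} (γ : Fin (d + 1) → ℝ) (v : EuclideanSpace ℝ (Fin (d + 1))) : ℝ :=
  1 / (2 * Real.pi) ^ ((d : ℝ) / 2) *
    Real.sqrt ((∑ k, γ k) ^ d / ∏ j, normalizedParam γ j) *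
    Real.exp (-(1 / 2) * ∑ j, (∑ k, γ k) * v j ^ 2 / normalizedParam γ j)

end

/-! The uniform local limit implies the distributional one. Put b = γ/α² and w_j = α v_j/γ̄_j. On
the hyperplane, the rescaled density is exactly its value at γ̄ (`rescaledPeak`) times exp(∑ (b_j -
1) log(1 + w_j)). Stirling's formula for real arguments gives the limit of the first factor. In the
exponent, the linear term ∑ b_j w_j is a multiple of ∑ v_j and vanishes. The quadratic term is -T/2
with T = ∑ γ₊ v_j²/γ̄_j. The rest is at most 2η(T + D), where η = O(|α|^ε) bounds every |w_j|. Since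
T is not bounded uniformly on the growing window, this error is not uniformly small by itself; the
Gaussian decay in T absorbs it (`abs_exp_sub_exp_neg_half_le`).

For convergence in distribution, an affine change of variables in the first d coordinates turns the
law of the rescaled vector into densities that converge pointwise to `limitDensity`. All have mass
one, so Scheffé's lemma applies. It remains to recognize the limit as the degenerate Gaussian. The
product Gaussian on ℝ^D with variances γ̄_j/γ₊ factors along the hyperplane ∑ v_j = 0 and the line
ℝγ̄, which are orthogonal for its precision form. Dividing out the characteristic function of the
line component subtracts γ̄γ̄ᵀ/γ₊ from the covariance and leaves Σ. -/

/-! ### Stirling's formula for real arguments -/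

/-- The deviation of `log Γ` from its Stirling approximation. -/
noncomputable def stirlingRemainder (x : ℝ) : ℝ :=
  Real.log (Real.Gamma x) - ((x - 1 / 2) * Real.log x - x + Real.log (2 * Real.pi) / 2)

lemma tendsto_stirlingRemainder_natCast :
    Tendsto (fun n : ℕ => stirlingRemainder n) atTop (𝓝 0) := by
  have hpi : (0 : ℝ) < √Real.pi := Real.sqrt_pos.2 Real.pi_pos
  have h1 : Tendsto (fun n => Real.log (Stirling.stirlingSeq n) - Real.log (√Real.pi)) atTop
      (𝓝 (Real.log (√Real.pi) - Real.log (√Real.pi))) :=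
    (Stirling.tendsto_stirlingSeq_sqrt_pi.log hpi.ne').sub_const _
  rw [sub_self] at h1
  refine h1.congr' ?_
  filter_upwards [eventually_ge_atTop 1] with n hn
  have hn0 : (0 : ℝ) < n := by exact_mod_cast hn
  have hfac : Real.log (n.factorial : ℝ) = Real.log n + Real.log (Real.Gamma n) := by
    rw [← Real.Gamma_nat_eq_factorial, Real.Gamma_add_one hn0.ne',
      Real.log_mul hn0.ne' (Real.Gamma_pos_of_pos hn0).ne']
  rw [Stirling.log_stirlingSeq_formula, hfac, stirlingRemainder,
    Real.log_sqrt Real.pi_pos.le, Real.log_mul two_ne_zero hn0.ne',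
    Real.log_mul two_ne_zero Real.pi_ne_zero, Real.log_div hn0.ne' (Real.exp_pos _).ne',
    Real.log_exp]
  ring

/-- Log-convexity of Γ: the slope of log Γ over [n, n + s] lies between its slopes over [n - 1, n]
and [n, n + 1]. -/
lemma log_Gamma_natCast_add_bounds {n : ℕ} (hn : 2 ≤ n) {s : ℝ} (hs : 0 ≤ s) (hs1 : s ≤ 1) :
    Real.log (Real.Gamma n) + s * Real.log (n - 1) ≤ Real.log (Real.Gamma (n + s)) ∧
      Real.log (Real.Gamma (n + s)) ≤ Real.log (Real.Gamma n) + s * Real.log n := by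
  rcases hs.eq_or_lt with rfl | hs
  · simp
  have feq : ∀ {y : ℝ}, 0 < y →
      (Real.log ∘ Real.Gamma) (y + 1) = (Real.log ∘ Real.Gamma) y + Real.log y := by
    intro y hy
    simp only [Function.comp]
    rw [Real.Gamma_add_one hy.ne', Real.log_mul hy.ne' (Real.Gamma_pos_of_pos hy).ne', add_comm]
  exact ⟨Real.BohrMollerup.f_add_nat_ge Real.convexOn_log_Gamma feq hn hs,
    Real.BohrMollerup.f_add_nat_le Real.convexOn_log_Gamma feq (by omega) hs hs1⟩

/-- Both log Γ and its Stirling approximation grow by about s log n between n and n + s. Each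
comparison costs at most 1/(n - 1), hence the 2. This carries the limit from integers to reals. -/
lemma abs_stirlingRemainder_natCast_add_sub_le {n : ℕ} (hn : 2 ≤ n) {s : ℝ} (hs : 0 ≤ s)
    (hs1 : s ≤ 1) :
    |stirlingRemainder (n + s) - stirlingRemainder n| ≤ 2 / ((n : ℝ) - 1) := by
  have hn2 : (2 : ℝ) ≤ n := by exact_mod_cast hn
  have hn0 : (0 : ℝ) < n := by linarith
  have hn1 : (0 : ℝ) < (n : ℝ) - 1 := by linarith
  obtain ⟨hlo, hhi⟩ := log_Gamma_natCast_add_bounds hn hs hs1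
  have hlog1 : -(1 / ((n : ℝ) - 1)) ≤ Real.log (n - 1) - Real.log n := by
    have := Real.one_sub_inv_le_log_of_pos (div_pos hn1 hn0)
    rw [Real.log_div hn1.ne' hn0.ne'] at this
    refine le_trans (le_of_eq ?_) this
    field_simp
    ring
  have hq : (0 : ℝ) < (n + s) / n := by positivity
  have hdiff : Real.log ((n + s) / n) = Real.log (n + s) - Real.log n :=
    Real.log_div (by positivity) hn0.ne'
  have hup : Real.log (n + s) - Real.log n ≤ s / n := by
    have := Real.log_le_sub_one_of_pos hq
    rw [hdiff] at this
    refine this.trans (le_of_eq ?_)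
    field_simp
    ring
  have hdown : s / (n + s) ≤ Real.log (n + s) - Real.log n := by
    have := Real.one_sub_inv_le_log_of_pos hq
    rw [hdiff] at this
    refine le_trans (le_of_eq ?_) this
    field_simp
    ring
  have hc : (0 : ℝ) ≤ n + s - 1 / 2 := by linarith
  have hup' := mul_le_mul_of_nonneg_left hup hc
  have hdown' := mul_le_mul_of_nonneg_left hdown hc
  have e1 : (n + s - 1 / 2) * (s / n) - s ≤ 1 / ((n : ℝ) - 1) := by
    have : (n + s - 1 / 2) * (s / n) - s = s * (s - 1 / 2) / n := by
      field_simp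
      ring
    rw [this]
    apply div_le_div₀ zero_le_one _ hn1 (by linarith)
    nlinarith
  have e2 : -(1 / ((n : ℝ) - 1)) ≤ (n + s - 1 / 2) * (s / (n + s)) - s := by
    have : (n + s - 1 / 2) * (s / (n + s)) - s = -(s / 2 / (n + s)) := by
      field_simp
      ring
    rw [this, neg_le_neg_iff]
    exact div_le_div₀ zero_le_one (by linarith) hn1 (by linarith)
  have e3 : -(1 / ((n : ℝ) - 1)) ≤ s * (Real.log (n - 1) - Real.log n) := by
    have h := mul_le_mul_of_nonneg_left hlog1 hs
    have : 0 ≤ 1 / ((n : ℝ) - 1) := by positivity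
    nlinarith
  have e4 : 2 / ((n : ℝ) - 1) = 1 / ((n : ℝ) - 1) + 1 / ((n : ℝ) - 1) := by ring
  have e5 : 0 ≤ 1 / ((n : ℝ) - 1) := by positivity
  rw [abs_le, e4]
  unfold stirlingRemainder
  constructor <;> nlinarith

/-- **Stirling's formula** for the Gamma function on the reals. -/
theorem tendsto_stirlingRemainder : Tendsto stirlingRemainder atTop (𝓝 0) := by
  have h1 : Tendsto (fun x : ℝ => stirlingRemainder ⌊x⌋₊) atTop (𝓝 0) :=
    tendsto_stirlingRemainder_natCast.comp tendsto_nat_floor_atTop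
  have h2 : Tendsto (fun x : ℝ => 2 / ((⌊x⌋₊ : ℝ) - 1)) atTop (𝓝 0) := by
    refine Tendsto.div_atTop tendsto_const_nhds ?_
    exact tendsto_atTop_add_const_right _ (-1)
      (tendsto_natCast_atTop_atTop.comp tendsto_nat_floor_atTop)
  have h3 : Tendsto (fun x : ℝ => stirlingRemainder x - stirlingRemainder ⌊x⌋₊) atTop (𝓝 0) := by
    refine squeeze_zero_norm' ?_ h2
    filter_upwards [eventually_ge_atTop 2] with x hx
    have hfl := Nat.floor_le (by linarith : (0 : ℝ) ≤ x)
    have hlt := Nat.lt_floor_add_one x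
    have := abs_stirlingRemainder_natCast_add_sub_le (n := ⌊x⌋₊) (s := x - ⌊x⌋₊)
      (Nat.le_floor (by exact_mod_cast hx)) (by linarith) (by linarith)
    rwa [add_sub_cancel] at this
  simpa using h3.add h1

/-! ### Estimates for the exponential and the logarithm -/

lemma abs_exp_sub_exp_le {a b M : ℝ} (ha : a ≤ M) (hb : b ≤ M) :
    |Real.exp a - Real.exp b| ≤ |a - b| * Real.exp M := by
  wlog hab : b ≤ a generalizing a b
  · rw [abs_sub_comm, abs_sub_comm a]
    exact this hb ha (le_of_not_ge hab)
  rw [abs_of_nonneg (sub_nonneg.2 (Real.exp_le_exp.2 hab)), abs_of_nonneg (sub_nonneg.2 hab)]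
  have h1 : Real.exp a - Real.exp b ≤ (a - b) * Real.exp a := by
    have h := mul_le_mul_of_nonneg_left (Real.add_one_le_exp (b - a)) (Real.exp_pos a).le
    rw [← Real.exp_add, add_sub_cancel] at h
    linarith
  exact h1.trans (mul_le_mul_of_nonneg_left (Real.exp_le_exp.2 ha) (sub_nonneg.2 hab))

/-- The bound does not depend on T. Because η ≤ 1/8, both exponents are at most -T/4 + m/4, and the
decay exp(-T/4) absorbs the factor T + m. -/
lemma abs_exp_sub_exp_neg_half_le {E T η m : ℝ} (hT : 0 ≤ T) (hη : 0 ≤ η) (hη1 : η ≤ 1 / 8)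
    (hm : 0 ≤ m) (h : |E + T / 2| ≤ 2 * η * (T + m)) :
    |Real.exp E - Real.exp (-(1 / 2) * T)| ≤ 2 * η * ((4 + m) * Real.exp (m / 4)) := by
  have h2 : 2 * η * (T + m) ≤ 1 / 4 * (T + m) :=
    mul_le_mul_of_nonneg_right (by linarith) (by linarith)
  have hE := (abs_le.1 h).2
  have h1 : |Real.exp E - Real.exp (-(1 / 2) * T)| ≤
      |E - -(1 / 2) * T| * Real.exp (-(T / 4) + m / 4) :=
    abs_exp_sub_exp_le (by linarith) (by linarith)
  have h3 : (T + m) * Real.exp (-(T / 4)) ≤ 4 + m := by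
    have ht : T + m ≤ (4 + m) * Real.exp (T / 4) := by
      have := Real.add_one_le_exp (T / 4)
      nlinarith
    calc (T + m) * Real.exp (-(T / 4)) ≤ ((4 + m) * Real.exp (T / 4)) * Real.exp (-(T / 4)) :=
          mul_le_mul_of_nonneg_right ht (Real.exp_pos _).le
      _ = 4 + m := by rw [mul_assoc, ← Real.exp_add]; simp
  have h4 : |E - -(1 / 2) * T| ≤ 2 * η * (T + m) := by
    rwa [show E - -(1 / 2) * T = E + T / 2 by ring]
  calc |Real.exp E - Real.exp (-(1 / 2) * T)|
      ≤ (2 * η * (T + m)) * Real.exp (-(T / 4) + m / 4) :=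
        h1.trans (mul_le_mul_of_nonneg_right h4 (Real.exp_pos _).le)
    _ = 2 * η * (((T + m) * Real.exp (-(T / 4))) * Real.exp (m / 4)) := by
        rw [Real.exp_add]; ring
    _ ≤ _ := by gcongr

lemma abs_log_one_add_le {w : ℝ} (hw : |w| ≤ 1 / 2) : |Real.log (1 + w)| ≤ 2 * |w| := by
  have h := Real.abs_log_sub_add_sum_range_le (x := -w) (by rw [abs_neg]; linarith) 0
  simp only [Finset.range_zero, Finset.sum_empty, abs_neg, sub_neg_eq_add, zero_add, pow_one] at h
  refine h.trans ?_
  rw [div_le_iff₀ (by linarith)]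
  nlinarith [abs_nonneg w]

lemma abs_log_one_add_sub_le {w : ℝ} (hw : |w| ≤ 1 / 2) :
    |Real.log (1 + w) - w + w ^ 2 / 2| ≤ 2 * |w| * w ^ 2 := by
  have h := Real.abs_log_sub_add_sum_range_le (x := -w) (by rw [abs_neg]; linarith) 2
  simp only [Finset.sum_range_succ, Finset.range_zero, Finset.sum_empty, abs_neg,
    sub_neg_eq_add] at h
  rw [show Real.log (1 + w) - w + w ^ 2 / 2 = 0 + (-w) ^ (0 + 1) / (((0 : ℕ) : ℝ) + 1)
    + (-w) ^ (1 + 1) / (((1 : ℕ) : ℝ) + 1) + Real.log (1 + w) by push_cast; ring]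
  refine h.trans ?_
  rw [div_le_iff₀ (by linarith), ← sq_abs]
  have h3 : 0 ≤ |w| ^ 3 * (1 / 2 - |w|) := mul_nonneg (by positivity) (by linarith)
  have h4 : 2 * |w| * |w| ^ 2 * (1 - |w|) = |w| ^ (2 + 1) + 2 * (|w| ^ 3 * (1 / 2 - |w|)) := by
    ring
  rw [h4]
  exact le_add_of_nonneg_right (by linarith)

/-- Second-order Taylor expansion of the logarithm, with the linear terms cancelling by `hsum`. The
cardinality comes from the -1 in b_j - 1, whose logarithms are bounded only to first order. -/
lemma abs_sum_log_one_add_le {ι : Type*} [Fintype ι] {b w : ι → ℝ} {η : ℝ} (hb : ∀ j, 0 ≤ b j)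
    (hw : ∀ j, |w j| ≤ η) (hη : η ≤ 1 / 2) (hsum : ∑ j, b j * w j = 0) :
    |∑ j, (b j - 1) * Real.log (1 + w j) + (∑ j, b j * w j ^ 2) / 2| ≤
      2 * η * (∑ j, b j * w j ^ 2 + Fintype.card ι) := by
  have h1 : ∑ j, (b j - 1) * Real.log (1 + w j) + (∑ j, b j * w j ^ 2) / 2 =
      ∑ j, (b j * (Real.log (1 + w j) - w j + w j ^ 2 / 2) - Real.log (1 + w j)) := by
    rw [← sub_zero (∑ j, (b j - 1) * Real.log (1 + w j) + _), ← hsum, Finset.sum_div,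
      ← Finset.sum_add_distrib, ← Finset.sum_sub_distrib]
    exact Finset.sum_congr rfl fun j _ => by ring
  have h2 : 2 * η * (∑ j, b j * w j ^ 2 + Fintype.card ι) =
      ∑ j, (b j * (2 * η * w j ^ 2) + 2 * η) := by
    rw [Finset.sum_add_distrib, Finset.sum_const, Finset.card_univ, nsmul_eq_mul, mul_add,
      Finset.mul_sum]
    congr 1
    · exact Finset.sum_congr rfl fun j _ => by ring
    · ring
  rw [h1, h2]
  refine (Finset.abs_sum_le_sum_abs _ _).trans (Finset.sum_le_sum fun j _ => ?_)
  refine (abs_sub _ _).trans (add_le_add ?_ ?_)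
  · rw [abs_mul, abs_of_nonneg (hb j)]
    refine mul_le_mul_of_nonneg_left ((abs_log_one_add_sub_le ((hw j).trans hη)).trans ?_) (hb j)
    have := hw j
    gcongr
  · exact (abs_log_one_add_le ((hw j).trans hη)).trans (by linarith [hw j])

/-! ### Local limit of the rescaled density -/

section Params

variable {D : ℕ} {γ : Fin D → ℝ}

lemma normalizedParam_apply (j : Fin D) : normalizedParam γ j = γ j / ∑ k, γ k := rfl

lemma normalizedParam_pos (hγ : ∀ j, 0 < γ j) (j : Fin D) : 0 < normalizedParam γ j :=
  div_pos (hγ j) (Finset.sum_pos (fun k _ => hγ k) ⟨j, Finset.mem_univ j⟩)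

lemma sum_normalizedParam (hs : ∑ k, γ k ≠ 0) : ∑ j, normalizedParam γ j = 1 := by
  simp_rw [normalizedParam_apply, ← Finset.sum_div]
  exact div_self hs

lemma mul_normalizedParam (hs : ∑ k, γ k ≠ 0) (j : Fin D) :
    (∑ k, γ k) * normalizedParam γ j = γ j := mul_div_cancel₀ _ hs

end Params

/-- The value at the normalized parameter of the density of `Dirichlet (γ / α²)` rescaled by
`|α|`. -/
noncomputable def rescaledPeak {d : ℕ} (γ : Fin (d + 1) → ℝ) (α : ℝ) : ℝ :=
  |α| ^ d * (Real.Gamma (∑ j, γ j / α ^ 2) / (∏ j, Real.Gamma (γ j / α ^ 2)) *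
    ∏ j, normalizedParam γ j ^ (γ j / α ^ 2 - 1))

/-- The normalizing constant of `limitDensity`. -/
noncomputable def limitPeak {d : ℕ} (γ : Fin (d + 1) → ℝ) : ℝ :=
  1 / (2 * Real.pi) ^ ((d : ℝ) / 2) * Real.sqrt ((∑ k, γ k) ^ d / ∏ j, normalizedParam γ j)

section LocalLimit

variable {d : ℕ} {γ : Fin (d + 1) → ℝ}

lemma sum_param_pos (hγ : ∀ j, 0 < γ j) : 0 < ∑ k, γ k :=
  Finset.sum_pos (fun k _ => hγ k) Finset.univ_nonempty

lemma limitPeak_pos (hγ : ∀ j, 0 < γ j) : 0 < limitPeak γ := by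
  have := sum_param_pos hγ
  have h2 : 0 < ∏ j, normalizedParam γ j := Finset.prod_pos fun j _ => normalizedParam_pos hγ j
  unfold limitPeak
  positivity

lemma log_limitPeak (hγ : ∀ j, 0 < γ j) :
    Real.log (limitPeak γ) = -(d / 2 * Real.log (2 * Real.pi)) + d / 2 * Real.log (∑ k, γ k)
      - (∑ j, Real.log (normalizedParam γ j)) / 2 := by
  have hs := sum_param_pos hγ
  have h2 : 0 < ∏ j, normalizedParam γ j := Finset.prod_pos fun j _ => normalizedParam_pos hγ j
  unfold limitPeak
  rw [Real.log_mul (by positivity) (by positivity), one_div, Real.log_inv,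
    Real.log_rpow (by positivity), Real.log_sqrt (by positivity),
    Real.log_div (by positivity) h2.ne', Real.log_pow,
    Real.log_prod fun j _ => (normalizedParam_pos hγ j).ne']
  ring

lemma rescaledPeak_pos (hγ : ∀ j, 0 < γ j) {α : ℝ} (hα : α ≠ 0) : 0 < rescaledPeak γ α := by
  have hb : ∀ j, 0 < γ j / α ^ 2 := fun j => div_pos (hγ j) (by positivity)
  refine mul_pos (by positivity) (mul_pos (div_pos ?_ ?_) ?_)
  · exact Real.Gamma_pos_of_pos (Finset.sum_pos (fun j _ => hb j) Finset.univ_nonempty)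
  · exact Finset.prod_pos fun j _ => Real.Gamma_pos_of_pos (hb j)
  · exact Finset.prod_pos fun j _ => Real.rpow_pos_of_pos (normalizedParam_pos hγ j) _

/-- Once each log Γ is replaced by its Stirling form, all divergent terms cancel exactly, so only
Stirling remainders depend on α. -/
lemma log_rescaledPeak (hγ : ∀ j, 0 < γ j) {α : ℝ} (hα : α ≠ 0) :
    Real.log (rescaledPeak γ α) = Real.log (limitPeak γ)
      + (stirlingRemainder (∑ j, γ j / α ^ 2) - ∑ j, stirlingRemainder (γ j / α ^ 2)) := by
  have hα2 : 0 < α ^ 2 := by positivity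
  have hs := sum_param_pos hγ
  have hb : ∀ j, 0 < γ j / α ^ 2 := fun j => div_pos (hγ j) hα2
  have hp := normalizedParam_pos hγ
  have hN : 0 < ∑ j, γ j / α ^ 2 := Finset.sum_pos (fun j _ => hb j) Finset.univ_nonempty
  have hNs : ∑ j, γ j / α ^ 2 = (∑ j, γ j) / α ^ 2 := (Finset.sum_div _ _ _).symm
  have hlogN : Real.log (∑ j, γ j / α ^ 2) = Real.log (∑ j, γ j) - 2 * Real.log |α| := by
    rw [hNs, Real.log_div hs.ne' hα2.ne', Real.log_pow, Real.log_abs]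
    push_cast
    ring
  -- With N = ∑ γ_j/α², each parameter is N γ̄_j; its logarithm splits so that the log N terms can
  -- be collected.
  have hlogb : ∀ j, Real.log (γ j / α ^ 2) =
      Real.log (∑ j, γ j / α ^ 2) + Real.log (normalizedParam γ j) := fun j => by
    rw [← Real.log_mul hN.ne' (hp j).ne', hNs, normalizedParam_apply]
    congr 1
    field_simp
  have hG : ∀ j, Real.Gamma (γ j / α ^ 2) ≠ 0 := fun j => (Real.Gamma_pos_of_pos (hb j)).ne'
  have hsum : ∑ j, stirlingRemainder (γ j / α ^ 2) = ∑ j, Real.log (Real.Gamma (γ j / α ^ 2))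
      - ∑ j, (γ j / α ^ 2 - 1) * Real.log (normalizedParam γ j)
      - (∑ j, Real.log (normalizedParam γ j)) / 2
      - (∑ j, γ j / α ^ 2) * Real.log (∑ j, γ j / α ^ 2)
      + (d + 1) / 2 * Real.log (∑ j, γ j / α ^ 2)
      + ∑ j, γ j / α ^ 2 - (d + 1) * (Real.log (2 * Real.pi) / 2) := by
    have hd : ((d : ℝ) + 1) = ∑ _j : Fin (d + 1), (1 : ℝ) := by simp
    rw [Finset.sum_mul, hd, Finset.sum_div, Finset.sum_div, Finset.sum_mul, Finset.sum_mul,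
      ← Finset.sum_sub_distrib, ← Finset.sum_sub_distrib, ← Finset.sum_sub_distrib,
      ← Finset.sum_add_distrib, ← Finset.sum_add_distrib, ← Finset.sum_sub_distrib]
    refine Finset.sum_congr rfl fun j _ => ?_
    rw [stirlingRemainder, hlogb]
    ring
  have hlog : Real.log (rescaledPeak γ α) = d * Real.log |α|
      + (Real.log (Real.Gamma (∑ j, γ j / α ^ 2)) - ∑ j, Real.log (Real.Gamma (γ j / α ^ 2))
      + ∑ j, (γ j / α ^ 2 - 1) * Real.log (normalizedParam γ j)) := by
    have hG0 := Finset.prod_ne_zero_iff.2 fun j (_ : j ∈ Finset.univ) => hG j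
    have hGN := (Real.Gamma_pos_of_pos hN).ne'
    have hpp : ∀ j ∈ Finset.univ, normalizedParam γ j ^ (γ j / α ^ 2 - 1) ≠ 0 :=
      fun j _ => (Real.rpow_pos_of_pos (hp j) _).ne'
    rw [rescaledPeak, Real.log_mul (by positivity)
      (mul_ne_zero (div_ne_zero hGN hG0) (Finset.prod_ne_zero_iff.2 hpp)),
      Real.log_mul (div_ne_zero hGN hG0) (Finset.prod_ne_zero_iff.2 hpp),
      Real.log_div hGN hG0, Real.log_pow, Real.log_prod hpp, Real.log_prod fun j _ => hG j]
    simp_rw [fun j => Real.log_rpow (hp j) (γ j / α ^ 2 - 1)]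
  rw [hlog, hsum, log_limitPeak hγ, stirlingRemainder, hlogN]
  ring

lemma tendsto_div_sq_nhdsNE_zero {c : ℝ} (hc : 0 < c) :
    Tendsto (fun α : ℝ => c / α ^ 2) (𝓝[≠] 0) atTop := by
  refine Tendsto.const_mul_atTop hc (tendsto_inv_nhdsGT_zero.comp ?_)
  refine tendsto_nhdsWithin_iff.2 ⟨?_, ?_⟩
  · have : Tendsto (fun α : ℝ => α ^ 2) (𝓝 0) (𝓝 (0 ^ 2)) := (continuous_pow 2).tendsto 0
    simpa using this.mono_left nhdsWithin_le_nhds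
  · filter_upwards [self_mem_nhdsWithin] with α hα
    exact sq_pos_of_ne_zero hα

lemma tendsto_rescaledPeak (hγ : ∀ j, 0 < γ j) :
    Tendsto (rescaledPeak γ) (𝓝[≠] 0) (𝓝 (limitPeak γ)) := by
  have h1 : Tendsto (fun α : ℝ => Real.log (limitPeak γ)
      + (stirlingRemainder (∑ j, γ j / α ^ 2) - ∑ j, stirlingRemainder (γ j / α ^ 2))) (𝓝[≠] 0)
      (𝓝 (Real.log (limitPeak γ) + (0 - ∑ _j : Fin (d + 1), 0))) := by
    refine tendsto_const_nhds.add (Tendsto.sub ?_ (tendsto_finsetSum _ fun j _ => ?_))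
    · refine tendsto_stirlingRemainder.comp ?_
      simp_rw [← Finset.sum_div]
      exact tendsto_div_sq_nhdsNE_zero (sum_param_pos hγ)
    · exact tendsto_stirlingRemainder.comp (tendsto_div_sq_nhdsNE_zero (hγ j))
  have h2 := h1.rexp
  simp only [Finset.sum_const_zero, sub_zero, add_zero, Real.exp_log (limitPeak_pos hγ)] at h2
  refine h2.congr' ?_
  filter_upwards [self_mem_nhdsWithin] with α hα
  rw [← log_rescaledPeak hγ hα, Real.exp_log (rescaledPeak_pos hγ hα)]

lemma dirichletDensity_add_smul (hγ : ∀ j, 0 < γ j) {α : ℝ} {v : EuclideanSpace ℝ (Fin (d + 1))}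
    (hv : ∑ j, v j = 0) (hw : ∀ j, |α * v j / normalizedParam γ j| < 1) :
    |α| ^ d * dirichletDensity (fun j => γ j / α ^ 2) (normalizedParam γ + α • v) =
      rescaledPeak γ α *
        Real.exp (∑ j, (γ j / α ^ 2 - 1) * Real.log (1 + α * v j / normalizedParam γ j)) := by
  have hp := normalizedParam_pos hγ
  have hpos : ∀ j, 0 < 1 + α * v j / normalizedParam γ j := fun j => by
    linarith [(abs_lt.1 (hw j)).1]
  have hcoord : ∀ j, (normalizedParam γ + α • v) j =
      normalizedParam γ j * (1 + α * v j / normalizedParam γ j) := fun j => by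
    have := (hp j).ne'
    simp only [PiLp.add_apply, PiLp.smul_apply, smul_eq_mul]
    field_simp
  have hmem : (∀ j, 0 ≤ (normalizedParam γ + α • v) j) ∧
      ∑ j, (normalizedParam γ + α • v) j = 1 := by
    refine ⟨fun j => (hcoord j).symm ▸ (mul_pos (hp j) (hpos j)).le, ?_⟩
    simp only [PiLp.add_apply, PiLp.smul_apply, smul_eq_mul, Finset.sum_add_distrib,
      ← Finset.mul_sum, hv, sum_normalizedParam (sum_param_pos hγ).ne']
    simp
  rw [dirichletDensity, if_pos hmem, rescaledPeak, Real.exp_sum, mul_assoc, mul_assoc,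
    ← Finset.prod_mul_distrib]
  congr 2
  refine Finset.prod_congr rfl fun j _ => ?_
  rw [hcoord, Real.mul_rpow (hp j).le (hpos j).le, Real.rpow_def_of_pos (hpos j), mul_comm
    (Real.log _)]

theorem eventually_abs_dirichletDensity_sub_limitDensity_lt (hγ : ∀ j, 0 < γ j) {ε δ : ℝ}
    (hε : 0 < ε) (hδ : 0 < δ) :
    ∀ᶠ α : ℝ in 𝓝[≠] (0 : ℝ), ∀ v : EuclideanSpace ℝ (Fin (d + 1)), ∑ j, v j = 0 →
      ‖v‖ ≤ |α| ^ (-1 + ε) →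
        |(|α| ^ d * dirichletDensity (fun j => γ j / α ^ 2) (normalizedParam γ + α • v))
          - limitDensity γ v| < δ := by
  have hp := normalizedParam_pos hγ
  have hs := sum_param_pos hγ
  -- A dominates every 1/γ̄_j, so η = A|α|^ε bounds all relative deviations α v_j/γ̄_j on the
  -- window.
  set A : ℝ := ∑ j, (normalizedParam γ j)⁻¹ with hA
  have hA0 : 0 ≤ A := Finset.sum_nonneg fun j _ => (inv_pos.2 (hp j)).le
  set C : ℝ := 2 * ((4 + (d + 1 : ℝ)) * Real.exp ((d + 1 : ℝ) / 4)) with hC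
  have hη : Tendsto (fun α : ℝ => A * |α| ^ ε) (𝓝[≠] 0) (𝓝 0) := by
    have h : Continuous fun α : ℝ => A * |α| ^ ε :=
      continuous_const.mul (continuous_abs.rpow_const fun _ => Or.inr hε.le)
    have := (h.tendsto 0).mono_left (nhdsWithin_le_nhds (s := {0}ᶜ))
    simpa [Real.zero_rpow hε.ne'] using this
  have hbound : Tendsto (fun α : ℝ => |rescaledPeak γ α - limitPeak γ| * (1 + A * |α| ^ ε * C)
      + limitPeak γ * (A * |α| ^ ε * C)) (𝓝[≠] 0) (𝓝 0) := by
    have h1 : Tendsto (fun α => |rescaledPeak γ α - limitPeak γ|) (𝓝[≠] 0) (𝓝 0) := by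
      simpa using ((tendsto_rescaledPeak hγ).sub_const (limitPeak γ)).abs
    have h2 := hη.mul_const C
    simpa using (h1.mul (h2.const_add 1)).add (h2.const_mul (limitPeak γ))
  filter_upwards [self_mem_nhdsWithin, hη.eventually_le_const (show (0 : ℝ) < 1 / 8 by norm_num),
    hbound.eventually_lt_const hδ] with α hα hsmall hlt v hv hnorm
  have hα : α ≠ 0 := hα
  have hα0 : 0 < |α| := abs_pos.2 hα
  have hη0 : 0 ≤ A * |α| ^ ε := by positivity
  have hw : ∀ j, |α * v j / normalizedParam γ j| ≤ A * |α| ^ ε := fun j => by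
    have h1 : |v j| ≤ |α| ^ (-1 + ε) := (PiLp.norm_apply_le v j).trans hnorm
    have h2 : (normalizedParam γ j)⁻¹ ≤ A :=
      Finset.single_le_sum (f := fun j => (normalizedParam γ j)⁻¹)
        (fun j _ => (inv_pos.2 (hp j)).le) (Finset.mem_univ j)
    have h3 : |α| * |α| ^ (-1 + ε) = |α| ^ ε := by
      rw [← Real.rpow_one_add' hα0.le (by simpa using hε.ne')]
      congr 1
      ring
    rw [abs_div, abs_mul, abs_of_pos (hp j), div_eq_mul_inv, ← h3, mul_comm A]
    have := (inv_pos.2 (hp j)).le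
    gcongr
  have hQ : ∑ j, γ j / α ^ 2 * (α * v j / normalizedParam γ j) ^ 2 =
      ∑ j, (∑ k, γ k) * v j ^ 2 / normalizedParam γ j := by
    refine Finset.sum_congr rfl fun j _ => ?_
    have := (hp j).ne'
    rw [← mul_normalizedParam hs.ne' j]
    field_simp
  have hlin : ∑ j, γ j / α ^ 2 * (α * v j / normalizedParam γ j) = 0 := by
    have : ∀ j, γ j / α ^ 2 * (α * v j / normalizedParam γ j) = (∑ k, γ k) / α * v j := fun j => by
      have := (hp j).ne'
      rw [← mul_normalizedParam hs.ne' j]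
      field_simp
    simp_rw [this, ← Finset.mul_sum, hv, mul_zero]
  have hexp := abs_sum_log_one_add_le (b := fun j => γ j / α ^ 2)
    (fun j => (div_pos (hγ j) (by positivity)).le) hw (hsmall.trans (by norm_num)) hlin
  simp only [hQ, Fintype.card_fin, Nat.cast_add, Nat.cast_one] at hexp
  have hT : 0 ≤ ∑ j, (∑ k, γ k) * v j ^ 2 / normalizedParam γ j :=
    Finset.sum_nonneg fun j _ => div_nonneg (by positivity) (hp j).le
  have hmain := abs_exp_sub_exp_neg_half_le hT hη0 hsmall (by positivity) hexp
  rw [dirichletDensity_add_smul hγ hv fun j => (hw j).trans_lt (by linarith)]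
  change |_ - limitPeak γ * Real.exp (-(1 / 2) * ∑ j, (∑ k, γ k) * v j ^ 2 / normalizedParam γ j)|
    < δ
  refine lt_of_le_of_lt ?_ hlt
  set E := ∑ j, (γ j / α ^ 2 - 1) * Real.log (1 + α * v j / normalizedParam γ j)
  set T := ∑ j, (∑ k, γ k) * v j ^ 2 / normalizedParam γ j
  have hmain' : |Real.exp E - Real.exp (-(1 / 2) * T)| ≤ A * |α| ^ ε * C := by
    refine hmain.trans (le_of_eq ?_)
    rw [hC]
    ring
  have hT1 : Real.exp (-(1 / 2) * T) ≤ 1 := Real.exp_le_one_iff.2 (by linarith)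
  have hE1 : Real.exp E ≤ 1 + A * |α| ^ ε * C := by
    linarith [(abs_le.1 hmain').2]
  -- The peak error is multiplied by exp E, which stays bounded because exp(-T/2) ≤ 1; the exponent
  -- error is multiplied by the fixed limiting peak.
  calc |rescaledPeak γ α * Real.exp E - limitPeak γ * Real.exp (-(1 / 2) * T)|
      = |(rescaledPeak γ α - limitPeak γ) * Real.exp E
          + limitPeak γ * (Real.exp E - Real.exp (-(1 / 2) * T))| := by congr 1; ring
    _ ≤ |rescaledPeak γ α - limitPeak γ| * Real.exp E
          + limitPeak γ * |Real.exp E - Real.exp (-(1 / 2) * T)| := by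
        refine (abs_add_le _ _).trans (le_of_eq ?_)
        rw [abs_mul, abs_mul, abs_of_pos (Real.exp_pos E), abs_of_pos (limitPeak_pos hγ)]
    _ ≤ _ := by
        have := (limitPeak_pos hγ).le
        gcongr

end LocalLimit

/-! ### Coordinates on the simplex and on its tangent hyperplane -/

/-- The parametrization of the hyperplane `∑ v_j = 0` in `ℝ^(d+1)` by the first `d`
coordinates. -/
noncomputable def tangentChart (d : ℕ) (x : Fin d → ℝ) : EuclideanSpace ℝ (Fin (d + 1)) :=
  WithLp.toLp 2 (Fin.snoc (α := fun _ => ℝ) x (-∑ j, x j))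

section Charts

variable {d : ℕ}

@[simp] lemma tangentChart_castSucc (x : Fin d → ℝ) (j : Fin d) :
    tangentChart d x j.castSucc = x j := by simp [tangentChart]

@[simp] lemma tangentChart_last (x : Fin d → ℝ) :
    tangentChart d x (Fin.last d) = -∑ j, x j := by simp [tangentChart]

@[simp] lemma simplexChart_castSucc (x : Fin d → ℝ) (j : Fin d) :
    simplexChart d x j.castSucc = x j := by simp [simplexChart]

@[simp] lemma simplexChart_last (x : Fin d → ℝ) :
    simplexChart d x (Fin.last d) = 1 - ∑ j, x j := by simp [simplexChart]

lemma sum_tangentChart (x : Fin d → ℝ) : ∑ j, tangentChart d x j = 0 := by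
  simp [Fin.sum_univ_castSucc]

lemma continuous_tangentChart : Continuous (tangentChart d) := by
  refine (PiLp.continuous_toLp 2 _).comp (continuous_pi fun i => ?_)
  refine Fin.lastCases ?_ (fun j => ?_) i
  · simp only [Fin.snoc_last]; fun_prop
  · simp only [Fin.snoc_castSucc]; fun_prop

lemma continuous_simplexChart : Continuous (simplexChart d) := by
  refine (PiLp.continuous_toLp 2 _).comp (continuous_pi fun i => ?_)
  refine Fin.lastCases ?_ (fun j => ?_) i
  · simp only [Fin.snoc_last]; fun_prop
  · simp only [Fin.snoc_castSucc]; fun_prop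

lemma simplexChart_add_smul {p : EuclideanSpace ℝ (Fin (d + 1))} (hp : ∑ j, p j = 1) (α : ℝ)
    (x : Fin d → ℝ) :
    simplexChart d ((fun j => p j.castSucc) + α • x) = p + α • tangentChart d x := by
  ext i
  refine Fin.lastCases ?_ (fun j => ?_) i
  · rw [Fin.sum_univ_castSucc] at hp
    simp [Finset.sum_add_distrib, ← Finset.mul_sum]
    linarith
  · simp

/-- The decomposition of `ℝ^(d+1)` along the hyperplane `∑ v_j = 0` and a vector `p` with
coordinates of sum `1` preserves Lebesgue measure. -/
lemma measurePreserving_smul_add_tangentChart {p : Fin (d + 1) → ℝ} (hp : ∑ j, p j = 1) :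
    MeasurePreserving (fun z : ℝ × (Fin d → ℝ) => fun i => tangentChart d z.2 i + z.1 * p i)
      (volume.prod volume) volume := by
  -- The map is a composition of two shears and a coordinate permutation. After the first shear adds
  -- s p_j to x_j, the second sends s to s - ∑ (x_j + s p_j), which is the last coordinate -∑ x_j +
  -- s p_last since p sums to 1.
  have h1 : MeasurePreserving (fun z : ℝ × (Fin d → ℝ) =>
      (z.1, (fun j : Fin d => z.1 * p j.castSucc) + z.2)) (volume.prod volume)
      (volume.prod volume) := by
    refine (MeasurePreserving.id volume).skew_product
      (g := fun (s : ℝ) (x : Fin d → ℝ) => (fun j : Fin d => s * p j.castSucc) + x)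
      (by simp only [Function.uncurry_def]; fun_prop)
      (ae_of_all _ fun s => map_add_left_eq_self _ _)
  have h2 : MeasurePreserving (fun z : (Fin d → ℝ) × ℝ => (z.1, -∑ j, z.1 j + z.2))
      (volume.prod volume) (volume.prod volume) := by
    refine (MeasurePreserving.id volume).skew_product
      (g := fun (x : Fin d → ℝ) (s : ℝ) => -∑ j, x j + s)
      (by simp only [Function.uncurry_def]; fun_prop)
      (ae_of_all _ fun x => map_add_left_eq_self _ _)
  have h3 := (volume_preserving_piFinSuccAbove (fun _ : Fin (d + 1) => ℝ) (Fin.last d)).symm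
  have h4 := h3.comp (Measure.measurePreserving_swap.comp
    (h2.comp (Measure.measurePreserving_swap.comp h1)))
  refine Eq.subst (motive := fun f => MeasurePreserving f (volume.prod volume) volume) ?_ h4
  funext z i
  simp only [Function.comp, MeasurableEquiv.piFinSuccAbove_symm_apply, Prod.swap,
    Fin.insertNthEquiv, Equiv.coe_fn_mk]
  refine Fin.lastCases ?_ (fun j => ?_) i
  · rw [Fin.sum_univ_castSucc] at hp
    have : p (Fin.last d) = 1 - ∑ j : Fin d, p j.castSucc := by linarith
    simp [Finset.sum_add_distrib, ← Finset.mul_sum, this]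
    ring
  · simp [add_comm]

end Charts

/-! ### Identification of the Gaussian limit -/

section GaussianLimit

variable {d : ℕ} {γ : Fin (d + 1) → ℝ}

lemma dotProduct_limitCovariance_mulVec (x : Fin (d + 1) → ℝ) :
    x ⬝ᵥ (limitCovariance γ).mulVec x = (∑ k, γ k)⁻¹ *
      (∑ j, normalizedParam γ j * x j ^ 2 - (∑ j, normalizedParam γ j * x j) ^ 2) := by
  rw [limitCovariance, Matrix.smul_mulVec, dotProduct_smul, Matrix.sub_mulVec, dotProduct_sub,
    Matrix.vecMulVec_mulVec, smul_eq_mul]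
  congr 2
  · exact Finset.sum_congr rfl fun j _ => by rw [Matrix.mulVec_diagonal]; ring
  · simp only [dotProduct, Pi.smul_apply, op_smul_eq_smul, smul_eq_mul, sq]
    rw [Finset.mul_sum]
    exact Finset.sum_congr rfl fun j _ => by ring

/-- The quadratic form at x is γ₊⁻¹ times the variance of x under the probability weights γ̄. -/
lemma posSemidef_limitCovariance (hγ : ∀ j, 0 < γ j) : (limitCovariance γ).PosSemidef := by
  refine Matrix.PosSemidef.of_dotProduct_mulVec_nonneg ?_ fun x => ?_
  · ext i j
    by_cases h : i = j
    · simp [h]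
    · simp [limitCovariance, Matrix.vecMulVec_apply, h, Ne.symm h,
        mul_comm (normalizedParam γ i)]
  · have hs := sum_param_pos hγ
    rw [star_trivial, dotProduct_limitCovariance_mulVec]
    refine mul_nonneg (inv_pos.2 hs).le (sub_nonneg.2 ?_)
    have h1 := sum_normalizedParam hs.ne'
    have h2 : 0 ≤ ∑ j, normalizedParam γ j * (x j - ∑ k, normalizedParam γ k * x k) ^ 2 :=
      Finset.sum_nonneg fun j _ => mul_nonneg (normalizedParam_pos hγ j).le (sq_nonneg _)
    set m := ∑ k, normalizedParam γ k * x k with hm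
    have h3 : ∑ j, normalizedParam γ j * (x j - m) ^ 2 =
        ∑ j, normalizedParam γ j * x j ^ 2 - 2 * m * ∑ j, normalizedParam γ j * x j
          + m ^ 2 * ∑ j, normalizedParam γ j := by
      rw [Finset.mul_sum (a := 2 * m), Finset.mul_sum (a := m ^ 2), ← Finset.sum_sub_distrib,
        ← Finset.sum_add_distrib]
      exact Finset.sum_congr rfl fun j _ => by ring
    rw [h3, h1, ← hm] at h2
    linarith

/-- Matches the normalizing constants in the splitting of the product Gaussian; the extra square
root belongs to the direction γ̄, with variance 1/γ₊. -/
lemma prod_sqrt_inv_eq (hγ : ∀ j, 0 < γ j) :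
    ∏ j, (√(2 * Real.pi * (normalizedParam γ j / ∑ k, γ k)))⁻¹ =
      (√(2 * Real.pi * (∑ k, γ k)⁻¹))⁻¹ * limitPeak γ := by
  have hs := sum_param_pos hγ
  have hp := normalizedParam_pos hγ
  have hpi := Real.pi_pos
  have hpos : ∀ j, 0 < (√(2 * Real.pi * (normalizedParam γ j / ∑ k, γ k)))⁻¹ := fun j => by
    have := hp j
    positivity
  have hK := limitPeak_pos hγ
  refine Real.log_injOn_pos (Finset.prod_pos fun j _ => hpos j)
    (show 0 < (√(2 * Real.pi * (∑ k, γ k)⁻¹))⁻¹ * limitPeak γ by positivity) ?_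
  rw [Real.log_prod fun j _ => (hpos j).ne', Real.log_mul (by positivity) hK.ne',
    log_limitPeak hγ, Real.log_inv, Real.log_sqrt (by positivity),
    Real.log_mul (by positivity) (by positivity), Real.log_inv]
  have : ∀ j, Real.log (√(2 * Real.pi * (normalizedParam γ j / ∑ k, γ k)))⁻¹ =
      -((Real.log (2 * Real.pi) - Real.log (∑ k, γ k)) / 2)
        - Real.log (normalizedParam γ j) / 2 := fun j => by
    have := hp j
    rw [Real.log_inv, Real.log_sqrt (by positivity), Real.log_mul (by positivity) (by positivity),
      Real.log_div (by positivity) (by positivity)]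
    ring
  simp_rw [this]
  rw [Finset.sum_sub_distrib, ← Finset.sum_div, Finset.sum_const, Finset.card_univ,
    Fintype.card_fin, nsmul_eq_mul]
  push_cast
  ring

/-- A product of centered Gaussian densities with variances `γ̄_j / γ₊` splits into
`limitDensity γ` along the hyperplane `∑ v_j = 0` and a Gaussian density along `γ̄`. -/
lemma prod_gaussianPDFReal_eq (hγ : ∀ j, 0 < γ j) {v : EuclideanSpace ℝ (Fin (d + 1))}
    (hv : ∑ j, v j = 0) (t : ℝ) :
    ∏ j, gaussianPDFReal 0 (normalizedParam γ j / ∑ k, γ k).toNNReal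
      (v j + t * normalizedParam γ j) =
      limitDensity γ v * gaussianPDFReal 0 (∑ k, γ k)⁻¹.toNNReal t := by
  have hs := sum_param_pos hγ
  have hp := normalizedParam_pos hγ
  have h1 := sum_normalizedParam hs.ne'
  have hc : ∀ j, (((normalizedParam γ j / ∑ k, γ k).toNNReal : NNReal) : ℝ) =
      normalizedParam γ j / ∑ k, γ k := fun j => Real.coe_toNNReal _ (div_pos (hp j) hs).le
  have hc' : (((∑ k, γ k)⁻¹.toNNReal : NNReal) : ℝ) = (∑ k, γ k)⁻¹ :=
    Real.coe_toNNReal _ (inv_pos.2 hs).le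
  have hexp : ∑ j, -(v j + t * normalizedParam γ j) ^ 2 /
      (2 * (normalizedParam γ j / ∑ k, γ k)) =
      -(1 / 2) * ∑ j, (∑ k, γ k) * v j ^ 2 / normalizedParam γ j
        + -t ^ 2 / (2 * (∑ k, γ k)⁻¹) := by
    have : ∀ j, -(v j + t * normalizedParam γ j) ^ 2 / (2 * (normalizedParam γ j / ∑ k, γ k)) =
        -(1 / 2) * ((∑ k, γ k) * v j ^ 2 / normalizedParam γ j) - t * (∑ k, γ k) * v j
          - t ^ 2 * (∑ k, γ k) / 2 * normalizedParam γ j := fun j => by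
      have := (hp j).ne'
      field_simp
      ring
    simp_rw [this]
    -- The cross terms add up to a multiple of ∑ v_j = 0: this is the orthogonality of γ̄ and the
    -- hyperplane.
    rw [Finset.sum_sub_distrib, Finset.sum_sub_distrib, ← Finset.mul_sum, ← Finset.mul_sum,
      ← Finset.mul_sum, hv, h1]
    field_simp
    ring
  simp only [gaussianPDFReal, sub_zero, hc, hc', Finset.prod_mul_distrib]
  rw [prod_sqrt_inv_eq hγ, ← Real.exp_sum, hexp, Real.exp_add,
    show limitDensity γ v = limitPeak γ * Real.exp (-(1 / 2) *
      ∑ j, (∑ k, γ k) * v j ^ 2 / normalizedParam γ j) from rfl]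
  ring

lemma integral_gaussianPDFReal_mul_cexp {v : ℝ} (hv : 0 < v) (t : ℝ) :
    ∫ z : ℝ, (gaussianPDFReal 0 v.toNNReal z : ℂ) * Complex.exp ((t * z : ℝ) * Complex.I) =
      Complex.exp ((-(v * t ^ 2 / 2) : ℝ)) := by
  have hv' : v.toNNReal ≠ 0 := (Real.toNNReal_pos.2 hv).ne'
  have h := charFun_gaussianReal (μ := 0) (v := v.toNNReal) t
  rw [charFun_apply_real, integral_gaussianReal_eq_integral_smul hv'] at h
  simp only [Complex.real_smul] at h
  push_cast
  rw [h]
  simp [Real.coe_toNNReal v hv.le]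

/-- The product Gaussian has a known characteristic function, and Fubini in the coordinates (s, x)
writes it as the wanted integral times the nonzero factor exp(-m²/(2γ₊)). Dividing gives the result.
-/
lemma integral_limitDensity_mul_cexp (hγ : ∀ j, 0 < γ j) (t : EuclideanSpace ℝ (Fin (d + 1))) :
    ∫ x : Fin d → ℝ, (limitDensity γ (tangentChart d x) : ℂ) *
        Complex.exp ((inner ℝ (tangentChart d x) t : ℝ) * Complex.I) =
      Complex.exp ((-(t.ofLp ⬝ᵥ (limitCovariance γ).mulVec t / 2) : ℝ)) := by
  have hs := sum_param_pos hγ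
  have hp := normalizedParam_pos hγ
  set m : ℝ := ∑ j, normalizedParam γ j * t j with hm
  have h1 : ∫ z : Fin (d + 1) → ℝ,
      ∏ j, ((gaussianPDFReal 0 (normalizedParam γ j / ∑ k, γ k).toNNReal (z j) : ℂ) *
        Complex.exp ((t j * z j : ℝ) * Complex.I)) =
      Complex.exp ((-((∑ k, γ k)⁻¹ * (∑ j, normalizedParam γ j * t j ^ 2) / 2) : ℝ)) := by
    rw [integral_fintype_prod_volume_eq_prod (fun j (z : ℝ) =>
      (gaussianPDFReal 0 (normalizedParam γ j / ∑ k, γ k).toNNReal z : ℂ) *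
        Complex.exp ((t j * z : ℝ) * Complex.I))]
    simp_rw [fun j => integral_gaussianPDFReal_mul_cexp (div_pos (hp j) hs) (t j)]
    rw [← Complex.exp_sum, ← Complex.ofReal_sum]
    congr 2
    rw [Finset.sum_neg_distrib, Finset.mul_sum, Finset.sum_div]
    exact congrArg _ (Finset.sum_congr rfl fun j _ => by ring)
  have hmp := measurePreserving_smul_add_tangentChart (sum_normalizedParam (γ := γ) hs.ne')
  have hcont : Continuous fun z : Fin (d + 1) → ℝ =>
      ∏ j, ((gaussianPDFReal 0 (normalizedParam γ j / ∑ k, γ k).toNNReal (z j) : ℂ) *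
        Complex.exp ((t j * z j : ℝ) * Complex.I)) := by
    unfold gaussianPDFReal
    fun_prop
  rw [← hmp.map_eq, integral_map hmp.measurable.aemeasurable hcont.aestronglyMeasurable] at h1
  have h2 : ∀ z : ℝ × (Fin d → ℝ),
      ∏ j, ((gaussianPDFReal 0 (normalizedParam γ j / ∑ k, γ k).toNNReal
          (tangentChart d z.2 j + z.1 * normalizedParam γ j) : ℂ) *
        Complex.exp ((t j * (tangentChart d z.2 j + z.1 * normalizedParam γ j) : ℝ) *
          Complex.I)) =
      ((gaussianPDFReal 0 (∑ k, γ k)⁻¹.toNNReal z.1 : ℂ) *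
        Complex.exp ((m * z.1 : ℝ) * Complex.I)) *
      ((limitDensity γ (tangentChart d z.2) : ℂ) *
        Complex.exp ((inner ℝ (tangentChart d z.2) t : ℝ) * Complex.I)) := fun z => by
    rw [Finset.prod_mul_distrib, ← Complex.ofReal_prod,
      prod_gaussianPDFReal_eq hγ (sum_tangentChart _), ← Complex.exp_sum, ← Finset.sum_mul,
      ← Complex.ofReal_sum]
    have : ∑ j, t j * (tangentChart d z.2 j + z.1 * normalizedParam γ j) =
        m * z.1 + inner ℝ (tangentChart d z.2) t := by
      rw [hm, Finset.sum_mul, PiLp.inner_apply, ← Finset.sum_add_distrib]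
      refine Finset.sum_congr rfl fun j _ => ?_
      simp only [RCLike.inner_apply, conj_trivial]
      ring
    rw [this, Complex.ofReal_add, add_mul, Complex.exp_add, Complex.ofReal_mul]
    ring
  simp only [h2] at h1
  rw [integral_prod_mul (fun s : ℝ => (gaussianPDFReal 0 (∑ k, γ k)⁻¹.toNNReal s : ℂ) *
        Complex.exp ((m * s : ℝ) * Complex.I)) (fun x : Fin d → ℝ =>
      (limitDensity γ (tangentChart d x) : ℂ) *
        Complex.exp ((inner ℝ (tangentChart d x) t : ℝ) * Complex.I)),
    integral_gaussianPDFReal_mul_cexp (inv_pos.2 hs)] at h1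
  rw [← mul_right_inj' (Complex.exp_ne_zero _), h1, ← Complex.exp_add, ← Complex.ofReal_add,
    dotProduct_limitCovariance_mulVec]
  congr 2
  ring

lemma limitDensity_nonneg (hγ : ∀ j, 0 < γ j) (v : EuclideanSpace ℝ (Fin (d + 1))) :
    0 ≤ limitDensity γ v :=
  mul_nonneg (limitPeak_pos hγ).le (Real.exp_pos _).le

lemma continuous_limitDensity_tangentChart :
    Continuous fun x => limitDensity γ (tangentChart d x) := by
  have := continuous_tangentChart (d := d)
  unfold limitDensity
  fun_prop

lemma integral_limitDensity (hγ : ∀ j, 0 < γ j) :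
    ∫ x, limitDensity γ (tangentChart d x) = 1 := by
  have h := integral_limitDensity_mul_cexp hγ 0
  simp only [inner_zero_right, Complex.ofReal_zero, zero_mul, Complex.exp_zero, mul_one,
    WithLp.ofLp_zero, zero_dotProduct, zero_div, neg_zero] at h
  rw [integral_complex_ofReal] at h
  exact_mod_cast h

lemma integrable_limitDensity (hγ : ∀ j, 0 < γ j) :
    Integrable fun x => limitDensity γ (tangentChart d x) :=
  -- A Bochner integral of a non-integrable function is 0 by convention, so total mass 1 yields
  -- integrability.
  Integrable.of_integral_ne_zero (by rw [integral_limitDensity hγ]; exact one_ne_zero)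

theorem multivariateGaussian_limitCovariance (hγ : ∀ j, 0 < γ j) :
    multivariateGaussian 0 (limitCovariance γ) =
      (volume.withDensity fun x => ENNReal.ofReal (limitDensity γ (tangentChart d x))).map
        (tangentChart d) := by
  have hfin : IsFiniteMeasure
      (volume.withDensity fun x => ENNReal.ofReal (limitDensity γ (tangentChart d x))) :=
    isFiniteMeasure_withDensity_ofReal (integrable_limitDensity hγ).2
  refine Measure.ext_of_charFun (funext fun t => ?_)
  rw [charFun_multivariateGaussian (posSemidef_limitCovariance hγ), charFun_apply,
    integral_map continuous_tangentChart.aemeasurable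
      (by fun_prop : Continuous _).aestronglyMeasurable,
    integral_withDensity_eq_integral_toReal_smul
      continuous_limitDensity_tangentChart.measurable.ennreal_ofReal
      (ae_of_all _ fun _ => ENNReal.ofReal_lt_top)]
  simp_rw [fun x => ENNReal.toReal_ofReal (limitDensity_nonneg hγ (tangentChart d x)),
    Complex.real_smul]
  rw [integral_limitDensity_mul_cexp hγ]
  simp

end GaussianLimit

/-! ### Passage from densities to distributions -/

/-- **Scheffé's lemma**, tested against a bounded function. -/
lemma tendsto_integral_mul_of_tendsto_ae {ι X : Type*} [MeasurableSpace X] {μ : Measure X}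
    {l : Filter ι} [l.IsCountablyGenerated] {f : ι → X → ℝ} {g φ : X → ℝ} {M : ℝ}
    (hφ : AEStronglyMeasurable φ μ) (hM : ∀ x, |φ x| ≤ M) (hg : Integrable g μ)
    (hg0 : ∀ x, 0 ≤ g x) (hf : ∀ᶠ i in l, Integrable (f i) μ) (hf0 : ∀ᶠ i in l, ∀ x, 0 ≤ f i x)
    (hfg : ∀ᶠ i in l, ∫ x, f i x ∂μ = ∫ x, g x ∂μ)
    (hlim : ∀ᵐ x ∂μ, Tendsto (fun i => f i x) l (𝓝 (g x))) :
    Tendsto (fun i => ∫ x, f i x * φ x ∂μ) l (𝓝 (∫ x, g x * φ x ∂μ)) := by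
  -- Unlike |f - g|, the positive part (g - f)⁺ is dominated by g. Equal total masses then give ∫ |f
  -- - g| = 2 ∫ (g - f)⁺.
  have h1 : Tendsto (fun i => ∫ x, max (g x - f i x) 0 ∂μ) l (𝓝 (∫ _, (0 : ℝ) ∂μ)) := by
    refine tendsto_integral_filter_of_dominated_convergence g ?_ ?_ hg ?_
    · filter_upwards [hf] with i hi
      exact (hg.sub hi).pos_part.aestronglyMeasurable
    · filter_upwards [hf0] with i hi
      refine ae_of_all _ fun x => ?_
      rw [Real.norm_of_nonneg (le_max_right _ _)]
      exact max_le (by linarith [hi x]) (hg0 x)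
    · filter_upwards [hlim] with x hx
      simpa using (hx.const_sub (g x)).max (tendsto_const_nhds (x := (0 : ℝ)))
  have h2 : Tendsto (fun i => M * (2 * ∫ x, max (g x - f i x) 0 ∂μ)) l (𝓝 0) := by
    simpa using (h1.const_mul 2).const_mul M
  rw [tendsto_iff_norm_sub_tendsto_zero]
  refine squeeze_zero' (Eventually.of_forall fun _ => norm_nonneg _) ?_ h2
  filter_upwards [hf, hfg] with i hi hig
  have hsub : Integrable (fun x => g x - f i x) μ := hg.sub hi
  have hpos : Integrable (fun x => max (g x - f i x) 0) μ := hsub.pos_part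
  have hφM : ∀ᵐ x ∂μ, ‖φ x‖ ≤ M := ae_of_all _ hM
  rw [← integral_sub (hi.mul_bdd hφ hφM) (hg.mul_bdd hφ hφM)]
  have habs : ∫ x, |f i x - g x| ∂μ = 2 * ∫ x, max (g x - f i x) 0 ∂μ := by
    have : ∀ x, |f i x - g x| = 2 * max (g x - f i x) 0 - (g x - f i x) := fun x => by
      rcases le_total (f i x) (g x) with h | h
      · rw [abs_of_nonpos (by linarith), max_eq_left (by linarith)]; ring
      · rw [abs_of_nonneg (by linarith), max_eq_right (by linarith)]; ring
    simp_rw [this]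
    rw [integral_sub (hpos.const_mul 2) hsub, integral_sub hg hi, hig, integral_const_mul]
    simp
  rw [← habs, ← integral_const_mul]
  refine norm_integral_le_of_norm_le ((hi.sub hg).abs.const_mul M) (ae_of_all _ fun x => ?_)
  rw [← sub_mul, norm_mul, mul_comm]
  exact mul_le_mul_of_nonneg_right (hM x) (norm_nonneg _)

section Dirichlet

variable {d : ℕ}

lemma measurable_dirichletDensity {D : ℕ} (b : Fin D → ℝ) : Measurable (dirichletDensity b) := by
  unfold dirichletDensity
  have h : MeasurableSet {v : EuclideanSpace ℝ (Fin D) | (∀ j, 0 ≤ v j) ∧ ∑ j, v j = 1} := by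
    simp only [Set.ofPred_and, Set.ofPred_forall]
    exact (MeasurableSet.iInter fun j => measurableSet_le measurable_const (by fun_prop)).inter
      (measurableSet_eq_fun (by fun_prop) measurable_const)
  exact Measurable.ite h (by fun_prop) measurable_const

lemma dirichletDensity_nonneg {D : ℕ} {b : Fin D → ℝ} (hb : ∀ j, 0 < b j)
    (v : EuclideanSpace ℝ (Fin D)) : 0 ≤ dirichletDensity b v := by
  unfold dirichletDensity
  split_ifs with h
  · refine mul_nonneg (div_nonneg ?_ ?_) ?_
    · exact Real.Gamma_nonneg_of_nonneg (Finset.sum_nonneg fun j _ => (hb j).le)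
    · exact Finset.prod_nonneg fun j _ => Real.Gamma_nonneg_of_nonneg (hb j).le
    · exact Finset.prod_nonneg fun j _ => Real.rpow_nonneg (h.1 j) _
  · exact le_rfl

lemma integral_dirichletMeasure {b : Fin (d + 1) → ℝ} (hb : ∀ j, 0 < b j)
    {F : EuclideanSpace ℝ (Fin (d + 1)) → ℝ} (hF : Measurable F) :
    ∫ w, F w ∂dirichletMeasure b =
      ∫ y, dirichletDensity b (simplexChart d y) * F (simplexChart d y) := by
  have hm : Measurable fun y => dirichletDensity b (simplexChart d y) :=
    (measurable_dirichletDensity b).comp continuous_simplexChart.measurable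
  rw [dirichletMeasure, integral_map continuous_simplexChart.aemeasurable
    hF.aestronglyMeasurable, integral_withDensity_eq_integral_toReal_smul hm.ennreal_ofReal
      (ae_of_all _ fun _ => ENNReal.ofReal_lt_top)]
  simp_rw [fun y => ENNReal.toReal_ofReal (dirichletDensity_nonneg hb (simplexChart d y)),
    smul_eq_mul]

/-- Substitution y = p' + αx, with p' the first d coordinates of p; the Jacobian |α|^d is the
scaling factor of the local limit. -/
lemma integral_comp_simplexChart {p : EuclideanSpace ℝ (Fin (d + 1))} (hp : ∑ j, p j = 1) {α : ℝ}
    (hα : α ≠ 0) (H : EuclideanSpace ℝ (Fin (d + 1)) → ℝ) :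
    ∫ y, H (simplexChart d y) = ∫ x, |α| ^ d * H (p + α • tangentChart d x) := by
  simp_rw [fun x => (simplexChart_add_smul hp α x).symm]
  rw [integral_const_mul, Measure.integral_comp_smul volume
    (fun y : Fin d → ℝ => H (simplexChart d ((fun j : Fin d => p j.castSucc) + y))) α,
    integral_add_left_eq_self (fun y => H (simplexChart d y))]
  have : |α| ^ d ≠ 0 := pow_ne_zero _ (abs_ne_zero.2 hα)
  rw [Module.finrank_fin_fun, abs_inv, abs_pow, smul_eq_mul, mul_inv_cancel_left₀ this]

end Dirichlet

section LocalLimit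

variable {d : ℕ} {γ : Fin (d + 1) → ℝ}

/-- A fixed point lies in the window ‖v‖ ≤ |α|^(-1/2) once α is small, so the uniform local limit
with ε = 1/2 applies. -/
lemma tendsto_rescaled_dirichletDensity (hγ : ∀ j, 0 < γ j) (x : Fin d → ℝ) :
    Tendsto (fun α : ℝ => |α| ^ d * dirichletDensity (fun j => γ j / α ^ 2)
      (normalizedParam γ + α • tangentChart d x)) (𝓝[≠] 0)
      (𝓝 (limitDensity γ (tangentChart d x))) := by
  rw [Metric.tendsto_nhds]
  intro δ hδ
  have h1 : Tendsto (fun α : ℝ => |α| ^ (-1 + 1 / 2 : ℝ)) (𝓝[≠] 0) atTop := by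
    have h := tendsto_rpow_neg_nhdsGT_zero (show (-1 + 1 / 2 : ℝ) < 0 by norm_num)
    exact h.comp (tendsto_nhdsWithin_iff.2 ⟨by
      simpa using (continuous_abs.tendsto (0 : ℝ)).mono_left nhdsWithin_le_nhds, by
      filter_upwards [self_mem_nhdsWithin] with α hα using abs_pos.2 hα⟩)
  filter_upwards [eventually_abs_dirichletDensity_sub_limitDensity_lt hγ
    (show (0 : ℝ) < 1 / 2 by norm_num) hδ, h1.eventually_ge_atTop ‖tangentChart d x‖]
    with α hα hn
  exact hα _ (sum_tangentChart x) hn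

end LocalLimit

theorem proposition2 {d : ℕ} (γ : Fin (d + 1) → ℝ) (hγ : ∀ j, 0 < γ j)
    {Ω : ℝ → Type*} [∀ α, MeasurableSpace (Ω α)]
    (P : (α : ℝ) → Measure (Ω α)) [∀ α, IsProbabilityMeasure (P α)]
    (u : (α : ℝ) → Ω α → EuclideanSpace ℝ (Fin (d + 1)))
    (hu : ∀ α : ℝ, α ≠ 0 → HasLaw (u α) (dirichletMeasure (fun j => γ j / α ^ 2)) (P α)) :
    TendstoInDistribution
      (fun (α : ℝ) (ω : Ω α) => α⁻¹ • (u α ω - normalizedParam γ)) (𝓝[≠] (0 : ℝ))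
      (id : EuclideanSpace ℝ (Fin (d + 1)) → EuclideanSpace ℝ (Fin (d + 1))) P
      (multivariateGaussian 0 (limitCovariance γ)) ∧
    ∀ ε : ℝ, 0 < ε → ε < 1 → ∀ δ : ℝ, 0 < δ → ∀ᶠ α : ℝ in 𝓝[≠] (0 : ℝ),
      ∀ v : EuclideanSpace ℝ (Fin (d + 1)), ∑ j, v j = 0 → ‖v‖ ≤ |α| ^ (-1 + ε) →
        |(|α| ^ d * dirichletDensity (fun j => γ j / α ^ 2) (normalizedParam γ + α • v))
          - limitDensity γ v| < δ := by
  refine ⟨?_, fun ε hε _ δ hδ => eventually_abs_dirichletDensity_sub_limitDensity_lt hγ hε hδ⟩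
  have hs := sum_param_pos hγ
  have hp := sum_normalizedParam (γ := γ) hs.ne'
  -- Measurability is needed at α = 0 too, where α⁻¹ = 0 makes the map constant.
  have haem : ∀ α, AEMeasurable (fun ω => α⁻¹ • (u α ω - normalizedParam γ)) (P α) := fun α => by
    rcases eq_or_ne α 0 with rfl | hα
    · simp only [inv_zero, zero_smul]
      exact aemeasurable_const
    · have := (hu α hα).aemeasurable
      fun_prop
  have hlaw : ∀ α, α ≠ 0 → ∀ F : EuclideanSpace ℝ (Fin (d + 1)) → ℝ, Measurable F →
      ∫ ω, F (α⁻¹ • (u α ω - normalizedParam γ)) ∂P α =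
        ∫ x, (|α| ^ d * dirichletDensity (fun j => γ j / α ^ 2)
          (normalizedParam γ + α • tangentChart d x)) * F (tangentChart d x) := by
    intro α hα F hF
    have hF' : Measurable fun w => F (α⁻¹ • (w - normalizedParam γ)) := hF.comp (by fun_prop)
    rw [← integral_map (hu α hα).aemeasurable (f := fun w => F (α⁻¹ • (w - normalizedParam γ)))
      hF'.aestronglyMeasurable, (hu α hα).map_eq,
      integral_dirichletMeasure (fun j => div_pos (hγ j) (by positivity)) hF',
      integral_comp_simplexChart hp hα (fun w => dirichletDensity (fun j => γ j / α ^ 2) w *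
        F (α⁻¹ • (w - normalizedParam γ)))]
    simp only [add_sub_cancel_left, inv_smul_smul₀ hα, mul_assoc]
  -- Testing the law against the constant 1 gives the mass because P α is a probability measure; the
  -- Dirichlet integral need not be evaluated.
  have hmass : ∀ α, α ≠ 0 → ∫ x, |α| ^ d * dirichletDensity (fun j => γ j / α ^ 2)
      (normalizedParam γ + α • tangentChart d x) = 1 := fun α hα => by
    have h := hlaw α hα (fun _ => 1) measurable_const
    simp only [mul_one] at h
    rw [← h]
    simp
  refine ⟨haem, aemeasurable_id, ?_⟩
  refine ProbabilityMeasure.tendsto_iff_forall_integral_tendsto.2 fun F => ?_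
  have hFm : Measurable F := F.continuous.measurable
  have hlimit : ∫ w, F w ∂((multivariateGaussian 0 (limitCovariance γ)).map id) =
      ∫ x, limitDensity γ (tangentChart d x) * F (tangentChart d x) := by
    rw [Measure.map_id, multivariateGaussian_limitCovariance hγ,
      integral_map continuous_tangentChart.aemeasurable hFm.aestronglyMeasurable,
      integral_withDensity_eq_integral_toReal_smul
        continuous_limitDensity_tangentChart.measurable.ennreal_ofReal
        (ae_of_all _ fun _ => ENNReal.ofReal_lt_top)]
    simp_rw [fun x => ENNReal.toReal_ofReal (limitDensity_nonneg hγ (tangentChart d x)),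
      smul_eq_mul]
  simp only [ProbabilityMeasure.coe_mk]
  rw [hlimit]
  have hscheffe := tendsto_integral_mul_of_tendsto_ae (l := 𝓝[≠] (0 : ℝ)) (M := ‖F‖)
    (φ := fun x => F (tangentChart d x))
    (F.continuous.comp continuous_tangentChart).aestronglyMeasurable
    (fun x => F.norm_coe_le_norm _) (integrable_limitDensity hγ)
    (fun x => limitDensity_nonneg hγ _)
    (f := fun α x => |α| ^ d * dirichletDensity (fun j => γ j / α ^ 2)
      (normalizedParam γ + α • tangentChart d x))
    (by
      filter_upwards [self_mem_nhdsWithin] with α hα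
      exact Integrable.of_integral_ne_zero (by rw [hmass α hα]; exact one_ne_zero))
    (by
      filter_upwards [self_mem_nhdsWithin] with α (hα : α ≠ 0) x
      exact mul_nonneg (by positivity)
        (dirichletDensity_nonneg (fun j => div_pos (hγ j) (by positivity)) _))
    (by
      filter_upwards [self_mem_nhdsWithin] with α hα
      rw [hmass α hα, integral_limitDensity hγ])
    (ae_of_all _ fun x => tendsto_rescaled_dirichletDensity hγ x)
  refine hscheffe.congr' ?_
  filter_upwards [self_mem_nhdsWithin] with α hα
  rw [integral_map (haem α) hFm.aestronglyMeasurable, hlaw α hα F hFm]
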